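/- Let $n\ge 0$ and let $(M,\varphi,\xi,\eta,g)$ be an almost contact complex Riemannian (accR) manifold of dimension $2n+1$: $M$ is a smooth $(2n+1)$-dimensional manifold, $g$ is a smooth pseudo-Riemannian metric of signature $(n+1,n)$, and $\varphi$, $\xi$, $\eta$ are respectively a smooth endomorphism field of $TM$, a smooth vector field and a smooth $1$-form with $$\varphi\xi=0,\quad \varphi^2=-\mathrm{id}+\eta\otimes\xi,\quad \eta\circ\varphi=0,\quad \eta(\xi)=1,\quad g(\varphi x,\varphi y)=-g(x,y)+\eta(x)\eta(y).$$ Let $\nabla$ be the Levi-Civita connection of $g$, and let $R(x,y)z=\nabla_x\nabla_yz-\nabla_y\nabla_xz-\nabla_{[x,y]}z$, $R(x,y,z,w)=g(R(x,y)z,w)$ be its curvature. For symmetric $(0,2)$-tensors $a,b$ let $$(a\mathbin{\bar\wedge} b)(x,y,z,w)=a(y,z)b(x,w)-a(x,z)b(y,w)+b(y,z)a(x,w)-b(x,z)a(y,w).$$ Assume that $M$ is cosymplectic (an $\mathcal F_0$-manifold), i.e. $F(x,y,z)=g((\nabla_x\varphi)y,z)=0$ for all $x,y,z$, and that $M$ admits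 an almost Riemann soliton with vertical potential: there are differentiable functions $\sigma,k$ on $M$ such that $\vartheta=k\,\xi$ satisfies $$2R+\sigma\,g\mathbin{\bar\wedge} g+g\mathbin{\bar\wedge}\mathcal L_\vartheta g=0.$$ Then $M$ is flat, i.e. $R=0$. Moreover, if $n\ge1$, then $\sigma=0$, $\mathrm dk(\xi)=0$ and $h_1=0$ on $M$, where $h_1(x,y)=\mathrm dk(x)\eta(y)+\mathrm dk(y)\eta(x)$. -/

import Mathlib

open Bundle VectorField
open scoped Manifold ContDiff

noncomputable section

section PseudoRiemannian

variable {E : Type*} [NormedAddCommGroup E] [NormedSpace ℝ E]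
  {H : Type*} [TopologicalSpace H] (I : ModelWithCorners ℝ E H)
  (M : Type*) [TopologicalSpace M] [ChartedSpace H M] [IsManifold I ∞ M]

/-- A smooth pseudo-Riemannian metric: a smooth field of nondegenerate symmetric bilinear forms
on the tangent spaces. -/
structure PseudoRiemannianMetric where
  /-- the bilinear form on each tangent space -/
  val : ∀ p : M, TangentSpace I p →L[ℝ] TangentSpace I p →L[ℝ] ℝ
  symm : ∀ (p : M) (v w : TangentSpace I p), val p v w = val p w v
  nondegenerate : ∀ (p : M) (v : TangentSpace I p), (∀ w, val p v w = 0) → v = 0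
  contMDiff : ContMDiff I (I.prod 𝓘(ℝ, E →L[ℝ] E →L[ℝ] ℝ)) ∞
    (fun p ↦ TotalSpace.mk' (E →L[ℝ] E →L[ℝ] ℝ) p (val p))

variable {I M}

namespace PseudoRiemannianMetric

variable (g : PseudoRiemannianMetric I M)

/-- The function `g(X, Y)` for vector fields `X`, `Y`. -/
def pair (X Y : ∀ p : M, TangentSpace I p) (p : M) : ℝ := g.val p (X p) (Y p)

/-- The right-hand side of the Koszul formula for `2 g(∇_X Y, Z)`:
`X g(Y,Z) + Y g(X,Z) - Z g(X,Y) + g([X,Y],Z) - g([X,Z],Y) - g([Y,Z],X)`. -/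
def koszul (X Y Z : ∀ p : M, TangentSpace I p) (p : M) : ℝ :=
  mvfderiv I (g.pair Y Z) p (X p) + mvfderiv I (g.pair X Z) p (Y p)
    - mvfderiv I (g.pair X Y) p (Z p)
    + g.pair (mlieBracket I X Y) Z p - g.pair (mlieBracket I X Z) Y p
    - g.pair (mlieBracket I Y Z) X p

variable {g} in
lemma mdifferentiableAt_pair {X Y : ∀ p : M, TangentSpace I p} {p : M}
    (hX : MDiffAt (T% X) p) (hY : MDiffAt (T% Y) p) : MDiffAt (g.pair X Y) p := by
  have : MDifferentiableAt I (I.prod 𝓘(ℝ)) (fun m ↦ TotalSpace.mk' ℝ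
      (E := Bundle.Trivial M ℝ) m (g.val m (X m) (Y m))) p := by
    apply MDifferentiableAt.clm_bundle_apply₂ (F₁ := E) (F₂ := E)
    · exact g.contMDiff.mdifferentiableAt (by simp)
    · exact hX
    · exact hY
  simp only [mdifferentiableAt_totalSpace] at this
  exact this.2

lemma pair_smul_left (f : M → ℝ) (X Y : ∀ p : M, TangentSpace I p) :
    g.pair (f • X) Y = f * g.pair X Y := by ext p; simp [pair]

lemma pair_smul_right (f : M → ℝ) (X Y : ∀ p : M, TangentSpace I p) :
    g.pair X (f • Y) = f * g.pair X Y := by ext p; simp [pair]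

lemma pair_add_left (X X' Y : ∀ p : M, TangentSpace I p) :
    g.pair (X + X') Y = g.pair X Y + g.pair X' Y := by ext p; simp [pair]

lemma pair_add_right (X Y Y' : ∀ p : M, TangentSpace I p) :
    g.pair X (Y + Y') = g.pair X Y + g.pair X Y' := by ext p; simp [pair]

lemma pair_comm (X Y : ∀ p : M, TangentSpace I p) : g.pair X Y = g.pair Y X := by
  ext p; exact g.symm p _ _

/-- The metric at `p` as a bilinear form. -/
def bilin (p : M) : LinearMap.BilinForm ℝ (TangentSpace I p) :=
  (ContinuousLinearMap.coeLM ℝ).comp (g.val p).toLinearMap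

lemma bilin_nondegenerate (p : M) : (g.bilin p).Nondegenerate :=
  ⟨fun v hv ↦ g.nondegenerate p v hv,
    fun v hv ↦ g.nondegenerate p v fun w ↦ (g.symm p v w).trans (hv w)⟩

lemma clm_ext_of_pair {p : M} {A B : TangentSpace I p →L[ℝ] TangentSpace I p}
    (h : ∀ X Z : ∀ p : M, TangentSpace I p, MDiffAt (T% X) p → MDiffAt (T% Z) p →
      2 * g.val p (A (X p)) (Z p) = 2 * g.val p (B (X p)) (Z p)) : A = B := by
  ext1 v
  rw [← sub_eq_zero]
  refine g.nondegenerate p _ fun w ↦ ?_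
  have := h (FiberBundle.extend E v) (FiberBundle.extend E w)
    (FiberBundle.mdifferentiableAt_extend ..) (FiberBundle.mdifferentiableAt_extend ..)
  simp only [FiberBundle.extend_apply_self] at this
  simp only [map_sub, sub_apply]
  linarith

variable [FiniteDimensional ℝ E]

lemma koszul_tensorial_left {Y Z : ∀ p : M, TangentSpace I p} {p : M}
    (hY : MDiffAt (T% Y) p) (hZ : MDiffAt (T% Z) p) :
    TensorialAt I E (fun X ↦ g.koszul X Y Z p) p where
  smul {f X} hf hX := by
    have : CompleteSpace E := FiniteDimensional.complete ℝ E
    simp only [koszul, pair_smul_left, mvfderiv_mul hf (mdifferentiableAt_pair hX hZ),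
      mvfderiv_mul hf (mdifferentiableAt_pair hX hY)]
    simp only [pair, mlieBracket_smul_left hf hX, Pi.smul_apply', map_smul, map_add]
    simp only [add_apply, smul_apply, smul_eq_mul,
      g.symm p (X p)]
    ring
  add {X X'} hX hX' := by
    have : CompleteSpace E := FiniteDimensional.complete ℝ E
    simp only [koszul, pair_add_left, mvfderiv_add (mdifferentiableAt_pair hX hZ)
      (mdifferentiableAt_pair hX' hZ), mvfderiv_add (mdifferentiableAt_pair hX hY)
      (mdifferentiableAt_pair hX' hY)]
    simp only [pair, mlieBracket_add_left hX hX', Pi.add_apply, map_add,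
      add_apply]
    ring

lemma koszul_tensorial_right {X Y : ∀ p : M, TangentSpace I p} {p : M}
    (hX : MDiffAt (T% X) p) (hY : MDiffAt (T% Y) p) :
    TensorialAt I E (fun Z ↦ g.koszul X Y Z p) p where
  smul {f Z} hf hZ := by
    have : CompleteSpace E := FiniteDimensional.complete ℝ E
    simp only [koszul, pair_smul_right, mvfderiv_mul hf (mdifferentiableAt_pair hX hZ),
      mvfderiv_mul hf (mdifferentiableAt_pair hY hZ)]
    simp only [pair, mlieBracket_smul_right hf hZ, Pi.smul_apply', Pi.mul_apply, map_smul, map_add]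
    simp only [add_apply, smul_apply, smul_eq_mul, g.symm p (Z p)]
    ring
  add {Z Z'} hZ hZ' := by
    have : CompleteSpace E := FiniteDimensional.complete ℝ E
    simp only [koszul, pair_add_right, mvfderiv_add (mdifferentiableAt_pair hX hZ)
      (mdifferentiableAt_pair hX hZ'), mvfderiv_add (mdifferentiableAt_pair hY hZ)
      (mdifferentiableAt_pair hY hZ')]
    simp only [pair, mlieBracket_add_right hZ hZ', Pi.add_apply, map_add,
      add_apply]
    ring

lemma koszul_add_middle {X Y Y' Z : ∀ p : M, TangentSpace I p} {p : M}
    (hX : MDiffAt (T% X) p) (hY : MDiffAt (T% Y) p) (hY' : MDiffAt (T% Y') p)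
    (hZ : MDiffAt (T% Z) p) :
    g.koszul X (Y + Y') Z p = g.koszul X Y Z p + g.koszul X Y' Z p := by
  have : CompleteSpace E := FiniteDimensional.complete ℝ E
  simp only [koszul, pair_add_right, pair_add_left, mvfderiv_add (mdifferentiableAt_pair hX hY)
    (mdifferentiableAt_pair hX hY'), mvfderiv_add (mdifferentiableAt_pair hY hZ)
    (mdifferentiableAt_pair hY' hZ)]
  simp only [pair, mlieBracket_add_right hY hY', mlieBracket_add_left hY hY', Pi.add_apply,
    map_add, add_apply]
  ring

lemma koszul_smul_middle {f : M → ℝ} {X Y Z : ∀ p : M, TangentSpace I p} {p : M}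
    (hf : MDiffAt f p) (hX : MDiffAt (T% X) p) (hY : MDiffAt (T% Y) p)
    (hZ : MDiffAt (T% Z) p) :
    g.koszul X (f • Y) Z p
      = f p * g.koszul X Y Z p + 2 * (mvfderiv I f p (X p) * g.val p (Y p) (Z p)) := by
  have : CompleteSpace E := FiniteDimensional.complete ℝ E
  simp only [koszul, pair_smul_right, pair_smul_left, mvfderiv_mul hf (mdifferentiableAt_pair hX hY),
    mvfderiv_mul hf (mdifferentiableAt_pair hY hZ)]
  simp only [pair, mlieBracket_smul_right hf hY, mlieBracket_smul_left hf hY, Pi.smul_apply',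
    Pi.mul_apply, map_smul, map_add]
  simp only [add_apply, smul_apply, smul_eq_mul, g.symm p (X p)]
  ring

/-- The operator of the Levi-Civita connection: `∇_v Y` at `p` is the tangent vector determined
by the Koszul formula `2 g(∇_v Y, w) = koszul v Y w` (and `0`, by convention, for a field `Y` that
is not differentiable at `p`). -/
def leviCivitaFun (Y : ∀ p : M, TangentSpace I p) (p : M) :
    TangentSpace I p →L[ℝ] TangentSpace I p :=
  open Classical in
  haveI : FiniteDimensional ℝ (TangentSpace I p) := inferInstanceAs (FiniteDimensional ℝ E)
  haveI : T2Space (TangentSpace I p) := inferInstanceAs (T2Space E)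
  if hY : MDiffAt (T% Y) p then
    LinearMap.toContinuousLinearMap
      (((g.bilin p).toDual (g.bilin_nondegenerate p)).symm.toLinearMap ∘ₗ
        (ContinuousLinearMap.coeLM ℝ) ∘ₗ ((1 / 2 : ℝ) •
          TensorialAt.mkHom₂ (fun X Z ↦ g.koszul X Y Z p) p
            (fun _ hZ ↦ g.koszul_tensorial_left hY hZ)
            (fun _ hX ↦ g.koszul_tensorial_right hX hY)).toLinearMap)
  else 0

lemma leviCivitaFun_spec {X Y Z : ∀ p : M, TangentSpace I p} {p : M}
    (hX : MDiffAt (T% X) p) (hY : MDiffAt (T% Y) p) (hZ : MDiffAt (T% Z) p) :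
    2 * g.val p (g.leviCivitaFun Y p (X p)) (Z p) = g.koszul X Y Z p := by
  have : FiniteDimensional ℝ (TangentSpace I p) := inferInstanceAs (FiniteDimensional ℝ E)
  rw [← TensorialAt.mkHom₂_apply (Φ := fun X Z ↦ g.koszul X Y Z p)
    (fun _ hZ ↦ g.koszul_tensorial_left hY hZ) (fun _ hX ↦ g.koszul_tensorial_right hX hY) hX hZ]
  simp only [leviCivitaFun, dif_pos hY]
  change 2 * g.bilin p (((g.bilin p).toDual (g.bilin_nondegenerate p)).symm _) (Z p) = _
  rw [LinearMap.BilinForm.apply_toDual_symm_apply]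
  simp

/-- The Levi-Civita connection of a pseudo-Riemannian metric. -/
def leviCivita : CovariantDerivative I E (TangentSpace I : M → Type _) where
  toFun := g.leviCivitaFun
  isCovariantDerivativeOnUniv :=
    { add := fun {Y Y' p} hY hY' _ ↦ g.clm_ext_of_pair fun X Z hX hZ ↦ by
        rw [g.leviCivitaFun_spec hX (mdifferentiableAt_add_section hY hY') hZ,
          g.koszul_add_middle hX hY hY' hZ, ← g.leviCivitaFun_spec hX hY hZ,
          ← g.leviCivitaFun_spec hX hY' hZ]
        simp only [add_apply, map_add]
        ring
      leibniz := fun {Y f p} hY hf _ ↦ g.clm_ext_of_pair fun X Z hX hZ ↦ by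
        rw [g.leviCivitaFun_spec hX (hf.smul_section hY) hZ,
          g.koszul_smul_middle hf hX hY hZ, ← g.leviCivitaFun_spec hX hY hZ]
        simp only [add_apply, map_add, smul_apply, map_smul, ContinuousLinearMap.smulRight_apply,
          smul_eq_mul]
        ring }

/-- The Levi-Civita connection is torsion-free. -/
lemma leviCivita_torsion_free {X Y : ∀ p : M, TangentSpace I p} {p : M}
    (hX : MDiffAt (T% X) p) (hY : MDiffAt (T% Y) p) :
    g.leviCivita Y p (X p) - g.leviCivita X p (Y p) = mlieBracket I X Y p := by
  rw [← sub_eq_zero]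
  refine g.nondegenerate p _ fun w ↦ ?_
  have hZ := FiberBundle.mdifferentiableAt_extend (I := I) E w
  have h1 := g.leviCivitaFun_spec hX hY hZ
  have h2 := g.leviCivitaFun_spec hY hX hZ
  simp only [koszul, g.pair_comm Y X, mlieBracket_swap (V := Y) (W := X)] at h1 h2
  simp only [pair, FiberBundle.extend_apply_self, Pi.neg_apply, map_neg, neg_apply] at h1 h2
  change g.val p (g.leviCivitaFun Y p (X p) - g.leviCivitaFun X p (Y p) - _) w = 0
  simp only [map_sub, sub_apply]
  linarith

/-- The Levi-Civita connection is compatible with the metric. -/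
lemma leviCivita_metric {X Y Z : ∀ p : M, TangentSpace I p} {p : M}
    (hX : MDiffAt (T% X) p) (hY : MDiffAt (T% Y) p) (hZ : MDiffAt (T% Z) p) :
    mvfderiv I (g.pair Y Z) p (X p)
      = g.val p (g.leviCivita Y p (X p)) (Z p) + g.val p (Y p) (g.leviCivita Z p (X p)) := by
  have h1 := g.leviCivitaFun_spec hX hY hZ
  have h2 := g.leviCivitaFun_spec hX hZ hY
  change _ = g.val p (g.leviCivitaFun Y p (X p)) (Z p) + g.val p (Y p) (g.leviCivitaFun Z p (X p))
  rw [g.symm p (Y p)]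
  simp only [koszul, g.pair_comm Z Y, mlieBracket_swap (V := Z) (W := Y)] at h1 h2
  simp only [pair, Pi.neg_apply, map_neg, neg_apply] at h1 h2
  linarith

/-- The curvature operator `R(X,Y)Z = ∇_X ∇_Y Z - ∇_Y ∇_X Z - ∇_[X,Y] Z`. -/
def curvature (X Y Z : ∀ p : M, TangentSpace I p) (p : M) : TangentSpace I p :=
  g.leviCivita (fun q ↦ g.leviCivita Z q (Y q)) p (X p)
    - g.leviCivita (fun q ↦ g.leviCivita Z q (X q)) p (Y p)
    - g.leviCivita Z p (mlieBracket I X Y p)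

/-- The curvature tensor of type `(0,4)`: `R(X,Y,Z,W) = g(R(X,Y)Z, W)`. -/
def curvature04 (p : M) (X Y Z W : ∀ p : M, TangentSpace I p) : ℝ :=
  g.pair (g.curvature X Y Z) W p

/-- The metric is flat: its curvature tensor vanishes identically. -/
def IsFlat : Prop :=
  ∀ (p : M) (X Y Z : ∀ p : M, TangentSpace I p),
    CMDiffAt ∞ (T% X) p → CMDiffAt ∞ (T% Y) p → CMDiffAt ∞ (T% Z) p → g.curvature X Y Z p = 0

/-- The Lie derivative of the metric along `V`:
`(L_V g)(X,Y) = V g(X,Y) - g([V,X],Y) - g(X,[V,Y])`. -/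
def lieDeriv (V : ∀ p : M, TangentSpace I p) (p : M) (X Y : ∀ p : M, TangentSpace I p) : ℝ :=
  mvfderiv I (g.pair X Y) p (V p) - g.pair (mlieBracket I V X) Y p - g.pair X (mlieBracket I V Y) p

end PseudoRiemannianMetric

/-- The Kulkarni-Nomizu product of two symmetric `(0,2)`-tensors. -/
def kulkarniNomizu {𝒳 : Type*} (a b : 𝒳 → 𝒳 → ℝ) (x y z w : 𝒳) : ℝ :=
  a y z * b x w - a x z * b y w + b y z * a x w - b x z * a y w

/-- `(g, ϑ, σ)` is an almost Riemann soliton: `ϑ` is a differentiable vector field, `σ` is a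
differentiable function, and `2 R + σ g ∧ g + g ∧ L_ϑ g = 0`, where `∧` is the Kulkarni-Nomizu
product. -/
structure IsAlmostRiemannSoliton [FiniteDimensional ℝ E] (g : PseudoRiemannianMetric I M)
    (ϑ : ∀ p : M, TangentSpace I p) (σ : M → ℝ) : Prop where
  mdifferentiable_potential : MDiff (T% ϑ)
  mdifferentiable_sigma : MDiff σ
  equation : ∀ (p : M) (X Y Z W : ∀ p : M, TangentSpace I p),
    CMDiffAt ∞ (T% X) p → CMDiffAt ∞ (T% Y) p → CMDiffAt ∞ (T% Z) p → CMDiffAt ∞ (T% W) p →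
    2 * g.curvature04 p X Y Z W
      + σ p * kulkarniNomizu (g.pair · · p) (g.pair · · p) X Y Z W
      + kulkarniNomizu (g.pair · · p) (g.lieDeriv ϑ p) X Y Z W = 0

variable (I M) in
/-- An almost contact complex Riemannian structure `(φ, ξ, η, g)` on a `(2n+1)`-dimensional
manifold (also called an almost contact B-metric structure), all tensor fields being smooth. -/
structure AccRStructure (n : ℕ) where
  g : PseudoRiemannianMetric I M
  φ : ∀ p : M, TangentSpace I p →L[ℝ] TangentSpace I p
  ξ : ∀ p : M, TangentSpace I p
  η : ∀ p : M, TangentSpace I p →L[ℝ] ℝ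
  contMDiff_φ : ContMDiff I (I.prod 𝓘(ℝ, E →L[ℝ] E)) ∞
    (fun p ↦ TotalSpace.mk' (E →L[ℝ] E) p (φ p))
  contMDiff_ξ : CMDiff ∞ (T% ξ)
  contMDiff_η : ContMDiff I (I.prod 𝓘(ℝ, E →L[ℝ] ℝ)) ∞
    (fun p ↦ TotalSpace.mk' (E →L[ℝ] ℝ) p (η p))
  /-- the dimension is `2n+1` -/
  finrank_eq : Module.finrank ℝ E = 2 * n + 1
  /-- `g` has signature `(n+1, n)` -/
  signature : ∀ p, _root_.sigPos (g.bilin p).toQuadraticMap = n + 1 ∧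
    _root_.sigNeg (g.bilin p).toQuadraticMap = n
  φ_ξ : ∀ p, φ p (ξ p) = 0
  φ_φ : ∀ p v, φ p (φ p v) = -v + η p v • ξ p
  η_φ : ∀ p v, η p (φ p v) = 0
  η_ξ : ∀ p, η p (ξ p) = 1
  g_φ_φ : ∀ p v w, g.val p (φ p v) (φ p w) = -g.val p v w + η p v * η p w

namespace AccRStructure

variable {n : ℕ} (S : AccRStructure I M n)

/-- The symmetric tensor `h₁ = dk ⊗ η + η ⊗ dk` of a function `k`. -/
def h₁ (k : M → ℝ) (p : M) (v w : TangentSpace I p) : ℝ :=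
  mvfderiv I k p v * S.η p w + mvfderiv I k p w * S.η p v

variable [FiniteDimensional ℝ E]

/-- The fundamental tensor `F(X,Y,Z) = g((∇_X φ)Y, Z)`, where
`(∇_X φ)Y = ∇_X (φY) - φ(∇_X Y)`. -/
def F (X Y Z : ∀ p : M, TangentSpace I p) (p : M) : ℝ :=
  S.g.val p (S.g.leviCivita (fun q ↦ S.φ q (Y q)) p (X p) - S.φ p (S.g.leviCivita Y p (X p))) (Z p)

/-- Cosymplectic accR manifolds (the class `F₀`): the tensor `F` vanishes, i.e. `∇φ = 0`. -/
def IsCosymplectic : Prop :=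
  ∀ (p : M) (X Y Z : ∀ p : M, TangentSpace I p),
    CMDiffAt ∞ (T% X) p → CMDiffAt ∞ (T% Y) p → CMDiffAt ∞ (T% Z) p → S.F X Y Z p = 0

end AccRStructure
end PseudoRiemannian
end

/-! When `∇φ = 0`, applying `∇` to `φξ = 0` and to `g(ξ,ξ) = 1` gives `∇ξ = 0`. Hence `L_{kξ} g = dk
⊗ η + η ⊗ dk`, and the curvature satisfies `R(x,y)ξ = 0` and `R(x,y)φz = φR(x,y)z`. The soliton
equation says that `-2R` is, at each point, an explicit tensor `K` built from `g`, `η`, `σ` and `θ =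
dk`. The claim thus reduces to algebra on one tangent space (`soliton_linear_algebra`).

There, `K(·,·,ξ,·) = 0` forces `θ = 0` on `ker η`, because `φ` is a complex structure on it, and
also `σ = -θ(ξ)`. On `ker η` what remains of `K` has constant-curvature form with factor `σ`.
Compatibility with `φ` would make every vector of `ker η` null if `σ ≠ 0`, which contradicts
nondegeneracy once `n ≥ 1`. If `n = 0`, `K` vanishes by antisymmetry.

The analytic point is that `∇_Y Z` must be differentiable before `∇` and `φ` can be commuted twice;
`contMDiffAt_leviCivita` supplies this. -/

open scoped Matrix

/-! ### Linear algebra on one tangent space. -/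

/-- The algebra of a vertical soliton at one point: if `K = σ g ∧ g + g ∧ (θ ⊗ η + η ⊗ θ)` satisfies
the identities `K(·,·,ξ,·) = 0` and `K(·,·,φ·,·) = K(·,·,·,φ·)` of a curvature tensor for which `φ`
and `ξ` are parallel, then `K = 0`, and `σ` and `θ` vanish unless the dimension is `1`. -/
theorem soliton_linear_algebra {V : Type*} [AddCommGroup V] [Module ℝ V] {n : ℕ}
    (hdim : Module.finrank ℝ V = 2 * n + 1) (g : V → V →ₗ[ℝ] ℝ) (hsymm : ∀ v w, g v w = g w v)
    (hnd : ∀ v, (∀ w, g v w = 0) → v = 0) (φ : V →ₗ[ℝ] V) (ξ : V) (η θ : V →ₗ[ℝ] ℝ) (σ : ℝ)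
    (hφξ : φ ξ = 0)
    (hφφ : ∀ v, φ (φ v) = -v + η v • ξ) (hηφ : ∀ v, η (φ v) = 0) (hηξ : η ξ = 1)
    (hg : ∀ v w, g (φ v) (φ w) = -g v w + η v * η w)
    (K : V → V → V → V → ℝ)
    (hK : ∀ x y z w, K x y z w = σ * kulkarniNomizu (fun v w ↦ g v w) (fun v w ↦ g v w) x y z w
      + kulkarniNomizu (fun v w ↦ g v w) (fun v w ↦ θ v * η w + θ w * η v) x y z w)
    (hKξ : ∀ x y w, K x y ξ w = 0) (hKφ : ∀ x y z w, K x y (φ z) w = K x y z (φ w)) :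
    (∀ x y z w, K x y z w = 0) ∧ (1 ≤ n → σ = 0 ∧ θ = 0) := by
  have hgξ (v) : g v ξ = η v := by
    have := hg v ξ
    rw [hφξ, map_zero, hηξ] at this
    linarith
  have hgξ' (v) : g ξ v = η v := by rw [hsymm, hgξ]
  have hgφ (v w) : g v (φ w) = g (φ v) w := by
    have h := hg v (φ w)
    rw [hφφ, hηφ, map_add, map_neg, map_smul, hgξ, hηφ, smul_zero] at h
    linarith
  obtain rfl | hn := Nat.eq_zero_or_pos n
  -- On a line spanned by `ξ`, every tensor is a multiple of a power of `η`, so antisymmetry of `K`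
  -- in `x, y` kills it, while `σ` and `θ` stay free.
  · refine ⟨fun x y z w ↦ ?_, fun h ↦ absurd h (by norm_num)⟩
    have hξ : ξ ≠ 0 := by rintro rfl; simp at hηξ
    have hv (v : V) : v = η v • ξ := by
      obtain ⟨c, rfl⟩ := (finrank_eq_one_iff_of_nonzero' ξ hξ).1 (by simpa using hdim) v
      simp [hηξ]
    have hg' (v w : V) : g v w = η v * η w := by
      conv_lhs => rw [hv w]
      rw [map_smul, hgξ, smul_eq_mul, mul_comm]
    have hθ (v) : θ v = η v * θ ξ := by
      conv_lhs => rw [hv v]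
      simp
    simp only [hK, kulkarniNomizu, hg', hθ x, hθ y, hθ z, hθ w]
    ring
  have key {x : V} (hx : η x = 0) (hx0 : x ≠ 0) : θ x = 0 := by
    -- For `x, y` in `ker η`, `K(x,y,ξ,w) = θ(y) g(x,w) - θ(x) g(y,w)`; take `y = φx`.
    have h (w) : g (θ (φ x) • x - θ x • φ x) w = 0 := by
      have := hKξ x (φ x) w
      simp only [hK, kulkarniNomizu, hgξ, hηφ, hx, hηξ] at this
      rw [hsymm, map_sub, map_smul, map_smul, hsymm w, hsymm w, smul_eq_mul, smul_eq_mul]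
      linarith
    have h1 := hnd _ h
    have h2 := congrArg φ h1
    simp only [map_sub, map_smul, hφφ, hx, zero_smul, add_zero, map_zero] at h2
    -- Since `φ² = -1` on `ker η`, `x` and `φx` are independent over `ℝ`; eliminating `φx` leaves a
    -- sum of squares times `x`.
    have h3 : (θ (φ x) ^ 2 + θ x ^ 2) • x = 0 := by
      have := congrArg₂ (fun a b ↦ θ (φ x) • a + θ x • b) h1 h2
      simp only [smul_zero, add_zero] at this
      rw [← this]
      module
    rcases smul_eq_zero.1 h3 with h | h
    · nlinarith [sq_nonneg (θ x), sq_nonneg (θ (φ x))]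
    · exact absurd h hx0
  have key' {x : V} (hx : η x = 0) : θ x = 0 := by
    by_cases h : x = 0
    · simp [h]
    · exact key hx h
  obtain ⟨x, hx, hx0⟩ : ∃ x, η x = 0 ∧ x ≠ 0 := by
    by_contra! H
    have : Module.finrank ℝ V ≤ 1 := finrank_le_one ξ fun v ↦
      ⟨η v, (sub_eq_zero.1 (H (v - η v • ξ) (by simp [hηξ]))).symm⟩
    omega
  -- For `x` in `ker η`, `K(x,ξ,ξ,w) = 2(σ + θ(ξ)) g(x,w)`.
  have hσθ : σ + θ ξ = 0 := by
    by_contra H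
    refine hx0 (hnd x fun w ↦ ?_)
    have := hKξ x ξ w
    simp only [hK, kulkarniNomizu, hgξ, hgξ', hx, hηξ] at this
    exact (mul_eq_zero.1 (show (σ + θ ξ) * g x w = 0 by linarith)).resolve_left H
  have hσ : σ = 0 := by
    by_contra H
    have nn {y : V} (hy : η y = 0) : g y y = 0 := by
      by_contra hyy
      -- The difference `K(y,φy,φy,w) - K(y,φy,y,φw)` equals `-4σ` times this pairing, because
      -- `g(φy,φy) = -g(y,y)` and `φ` is self-adjoint.
      have h (w) : g (g y y • y + g y (φ y) • φ y) w = 0 := by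
        have := hKφ y (φ y) y w
        simp only [hK, kulkarniNomizu, hηφ, hy, hgφ, hφφ, key' hy, key' (hηφ y),
          zero_smul, add_zero] at this
        rw [hsymm, map_add, map_smul, map_smul, hsymm w, hsymm w, smul_eq_mul, smul_eq_mul, hgφ]
        have e (w) : g (-y) w = -g y w := by rw [hsymm, map_neg, hsymm]
        have e2 : g (φ y) y = g y (φ y) := hsymm _ _
        rw [e, e] at this
        refine (mul_eq_zero.1 (show σ * _ = 0 from ?_)).resolve_left H
        linear_combination (-1/4) * this
      have h1 := hnd _ h
      have h2 := congrArg φ h1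
      simp only [map_add, map_smul, hφφ, hy, zero_smul, add_zero, map_zero] at h2
      have h3 : (g y y ^ 2 + g y (φ y) ^ 2) • y = 0 := by
        have := congrArg₂ (fun a b ↦ g y y • a - g y (φ y) • b) h1 h2
        simp only [smul_zero, sub_zero] at this
        rw [← this]
        module
      rcases smul_eq_zero.1 h3 with h | h
      · exact hyy (by nlinarith [sq_nonneg (g y y), sq_nonneg (g y (φ y))])
      · exact hyy (by rw [h, map_zero])
    refine hx0 (hnd x fun w ↦ ?_)
    -- Polarization: `g` vanishes on `ker η`, so `x`, being also orthogonal to `ξ`, lies in the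
    -- radical.
    set w' := w - η w • ξ with hw'
    have hw0 : η w' = 0 := by simp [hw', hηξ]
    have e : g x w = g x w' := by simp [hw', hgξ, hx]
    have h1 := nn (y := x + w') (by simp [hx, hw0])
    rw [map_add, hsymm _ x, hsymm _ w', map_add, map_add, nn hx, nn hw0, hsymm w' x] at h1
    linarith
  have hθ : θ = 0 := by
    ext v
    have h1 : θ (v - η v • ξ) = 0 := key' (by simp [hηξ])
    have h2 : θ ξ = 0 := by linarith
    simpa [h2] using h1
  refine ⟨fun x y z w ↦ ?_, fun _ ↦ ⟨hσ, hθ⟩⟩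
  simp [hK, hσ, hθ, kulkarniNomizu]

/-! ### Smoothness of the Levi-Civita derivative. -/

section
variable {E : Type*} [NormedAddCommGroup E] [NormedSpace ℝ E]
  {H : Type*} [TopologicalSpace H] {I : ModelWithCorners ℝ E H}
  {M : Type*} [TopologicalSpace M] [ChartedSpace H M] 

theorem ContMDiffAt.matrix_det {ι : Type*} [Fintype ι] [DecidableEq ι]
    {A : M → Matrix ι ι ℝ} {p : M} (hA : ∀ i j, CMDiffAt ∞ (fun q ↦ A q i j) p) :
    CMDiffAt ∞ (fun q ↦ (A q).det) p := by
  have h1 : ContDiff ℝ ∞ (fun B : ι → ι → ℝ ↦ (Matrix.of B).det) := by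
    simp only [Matrix.det_apply, Matrix.of_apply]
    fun_prop
  have h2 : ContMDiffAt I 𝓘(ℝ, ι → ι → ℝ) ∞ (fun q ↦ (fun i j ↦ A q i j : ι → ι → ℝ)) p :=
    contMDiffAt_pi_space.2 fun i ↦ contMDiffAt_pi_space.2 (hA i)
  exact (h1.contMDiff _).comp p h2

variable [IsManifold I ∞ M]

/-- Being `C^∞` at a point does not provide one neighbourhood of `C^∞` regularity, but being `C^1`
there does provide a `C^1` neighbourhood. -/
theorem ContMDiffAt.eventually_mdifferentiableAt_section {X : ∀ p : M, TangentSpace I p} {p : M}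
    (hX : CMDiffAt ∞ (T% X) p) : ∀ᶠ q in nhds p, MDiffAt (T% X) q :=
  ((contMDiffAt_iff_contMDiffAt_nhds (by simp)).1
    (hX.of_le (m := 1) (by exact_mod_cast le_top))).mono fun _ h ↦ h.mdifferentiableAt (by simp)

theorem ContMDiffAt.mvfderiv_apply {f : M → ℝ} {X : ∀ p : M, TangentSpace I p} {p : M}
    (hf : CMDiffAt ∞ f p) (hX : CMDiffAt ∞ (T% X) p) :
    CMDiffAt ∞ (fun q ↦ mvfderiv I f q (X q)) p := by
  have h1 := hf.mfderiv_const (m := ∞) (by simp)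
  have h2 := h1.clm_apply_of_inCoordinates (b₁ := id) (b₂ := f) hX hf
  rw [contMDiffAt_totalSpace] at h2
  refine h2.2.congr_of_eventuallyEq (Filter.Eventually.of_forall fun q ↦ ?_)
  simp [mvfderiv]
  rfl

namespace PseudoRiemannianMetric
variable {g : PseudoRiemannianMetric I M}

theorem contMDiffAt_pair {X Y : ∀ p : M, TangentSpace I p} {p : M}
    (hX : CMDiffAt ∞ (T% X) p) (hY : CMDiffAt ∞ (T% Y) p) : CMDiffAt ∞ (g.pair X Y) p := by
  have : ContMDiffAt I (I.prod 𝓘(ℝ)) ∞ (fun m ↦ TotalSpace.mk' ℝ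
      (E := Bundle.Trivial M ℝ) m (g.val m (X m) (Y m))) p := by
    apply ContMDiffAt.clm_bundle_apply₂ (F₁ := E) (F₂ := E)
    · exact g.contMDiff p
    · exact hX
    · exact hY
  rw [contMDiffAt_totalSpace] at this
  exact this.2

variable [FiniteDimensional ℝ E]

theorem contMDiffAt_koszul {X Y Z : ∀ p : M, TangentSpace I p} {p : M}
    (hX : CMDiffAt ∞ (T% X) p) (hY : CMDiffAt ∞ (T% Y) p) (hZ : CMDiffAt ∞ (T% Z) p) :
    CMDiffAt ∞ (g.koszul X Y Z) p := by
  have : CompleteSpace E := FiniteDimensional.complete ℝ E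
  have : IsManifold I ((⊤ : ℕ∞) + 1) M := by simpa
  have : IsManifold I (minSmoothness ℝ 2) M := by simp; infer_instance
  have : IsManifold I (minSmoothness ℝ 3) M := by simp; infer_instance
  have bracket {U V : ∀ p : M, TangentSpace I p} (hU : CMDiffAt ∞ (T% U) p)
      (hV : CMDiffAt ∞ (T% V) p) : CMDiffAt ∞ (T% (mlieBracket I U V)) p :=
    ContMDiffAt.mlieBracket_vectorField (m := ⊤) (n := ⊤) hU hV (by simp)
  exact (((((contMDiffAt_pair hY hZ).mvfderiv_apply hX).add
    ((contMDiffAt_pair hX hZ).mvfderiv_apply hY)).sub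
    ((contMDiffAt_pair hX hY).mvfderiv_apply hZ)).add
    (contMDiffAt_pair (bracket hX hY) hZ)).sub
    (contMDiffAt_pair (bracket hX hZ) hY) |>.sub (contMDiffAt_pair (bracket hY hZ) hX)

/-- A vector field whose inner products with smooth vector fields are smooth is
smooth. -/
theorem contMDiffAt_of_pair {W : ∀ p : M, TangentSpace I p} {p : M}
    (h : ∀ Z : ∀ p : M, TangentSpace I p, CMDiffAt ∞ (T% Z) p → CMDiffAt ∞ (g.pair W Z) p) :
    CMDiffAt ∞ (T% W) p := by
  classical
  let t := trivializationAt E (TangentSpace I) p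
  have hp : p ∈ t.baseSet := FiberBundle.mem_baseSet_trivializationAt E _ p
  let b := Module.finBasis ℝ E
  let s := t.localFrame b
  have hs (i) : CMDiffAt ∞ (T% (s i)) p := contMDiffAt_localFrame_of_mem ∞ t b i hp
  rw [contMDiffAt_iff_localFrameCoeff b hp]
  intro i
  -- The frame coefficients of `W` solve a linear system with Gram matrix `G` and right side `c`;
  -- Cramer's rule makes them quotients of smooth determinants.
  let G (q : M) : Matrix _ _ ℝ := .of fun i j ↦ g.pair (s j) (s i) q
  let c (q : M) (i) : ℝ := g.pair W (s i) q
  have hG0 {q} (hq : q ∈ t.baseSet) : (G q).det ≠ 0 := by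
    intro hdet
    obtain ⟨v, hv0, hv⟩ := Matrix.exists_mulVec_eq_zero_iff.2 hdet
    refine hv0 ?_
    have hsq (j) : s j q = t.basisAt b hq j := Trivialization.localFrame_apply_of_mem_baseSet t b hq
    have h0 : ∑ j, v j • t.basisAt b hq j = 0 := by
      refine g.bilin_nondegenerate q |>.1 _ fun w ↦ ?_
      rw [← (t.basisAt b hq).sum_repr w, map_sum]
      refine Finset.sum_eq_zero fun i _ ↦ ?_
      have := congrFun hv i
      simp only [G, Matrix.mulVec, dotProduct, Matrix.of_apply, pair, hsq, Pi.zero_apply] at this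
      rw [map_smul, map_sum, LinearMap.sum_apply]
      simp only [map_smul, LinearMap.smul_apply, smul_eq_mul]
      rw [← mul_zero (((t.basisAt b hq).repr w) i), ← this]
      congr 1
      exact Finset.sum_congr rfl fun j _ ↦ mul_comm _ _
    exact funext fun j ↦ Fintype.linearIndependent_iff.1 (t.basisAt b hq).linearIndependent v h0 j
  have hc {q} (hq : q ∈ t.baseSet) :
      t.localFrameCoeff I b i q (W q) = (G q).det⁻¹ * ((G q).updateCol i (c q)).det := by
    rw [eq_inv_mul_iff_mul_eq₀ (hG0 hq)]
    let w (j) := t.localFrameCoeff I b j q (W q)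
    have : G q *ᵥ w = c q := by
      ext k
      have hW : W q = ∑ j, w j • s j q := t.eq_sum_localFrameCoeff_smul hq
      simp only [G, c, pair, Matrix.mulVec, dotProduct, Matrix.of_apply]
      rw [hW, map_sum, sum_apply]
      refine Finset.sum_congr rfl fun j _ ↦ ?_
      rw [map_smul, smul_apply, smul_eq_mul, mul_comm]
    rw [← this, ← Matrix.cramer_apply, Matrix.cramer_eq_adjugate_mulVec, Matrix.mulVec_mulVec,
      Matrix.adjugate_mul, Matrix.smul_mulVec, Matrix.one_mulVec]
    rfl
  have hGd (k j) : CMDiffAt ∞ (fun q ↦ G q k j) p := contMDiffAt_pair (hs j) (hs k)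
  have hinv : CMDiffAt ∞ (fun q ↦ (G q).det⁻¹) p :=
    (contDiffAt_inv ℝ (hG0 hp)).contMDiffAt.comp p (.matrix_det hGd)
  have hdet : CMDiffAt ∞ (fun q ↦ ((G q).updateCol i (c q)).det) p := by
    refine .matrix_det fun k j ↦ ?_
    by_cases hj : j = i
    · subst hj
      simpa only [Matrix.updateCol_self] using h _ (hs k)
    · simpa only [Matrix.updateCol_ne hj] using hGd k j
  exact (hinv.mul hdet).congr_of_eventuallyEq <|
    Filter.eventuallyEq_of_mem (t.open_baseSet.mem_nhds hp) fun q hq ↦ hc hq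

/-- By Koszul, `g(∇_X Y, Z)` is smooth for every smooth `Z`. So iterated derivatives, as in the
curvature, never meet the default value `0` of `leviCivitaFun` at `p`. -/
theorem contMDiffAt_leviCivita {X Y : ∀ p : M, TangentSpace I p} {p : M}
    (hX : CMDiffAt ∞ (T% X) p) (hY : CMDiffAt ∞ (T% Y) p) :
    CMDiffAt ∞ (T% (fun q ↦ g.leviCivita Y q (X q))) p := by
  refine contMDiffAt_of_pair (g := g) fun Z hZ ↦ ?_
  have h := (contMDiffAt_const (c := (1 / 2 : ℝ))).mul (contMDiffAt_koszul (g := g) hX hY hZ)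
  refine h.congr_of_eventuallyEq ?_
  filter_upwards [hX.eventually_mdifferentiableAt_section, hY.eventually_mdifferentiableAt_section,
    hZ.eventually_mdifferentiableAt_section] with q h1 h2 h3
  have := g.leviCivitaFun_spec h1 h2 h3
  simp only [pair, Pi.mul_apply, ← this]
  change g.val q (g.leviCivitaFun Y q (X q)) (Z q) = _
  ring
end PseudoRiemannianMetric
end

/-! ### Parallel structure tensors and the soliton equation. -/

section
variable {E : Type*} [NormedAddCommGroup E] [NormedSpace ℝ E]
  {H : Type*} [TopologicalSpace H] {I : ModelWithCorners ℝ E H}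
  {M : Type*} [TopologicalSpace M] [ChartedSpace H M] [IsManifold I ∞ M]

namespace AccRStructure
variable {n : ℕ} (S : AccRStructure I M n)

theorem g_ξ (p : M) (v : TangentSpace I p) : S.g.val p v (S.ξ p) = S.η p v := by
  have := S.g_φ_φ p v (S.ξ p)
  rw [S.φ_ξ, map_zero, S.η_ξ] at this
  linarith

/-- The minus sign in the compatibility of `g` with `φ` makes `φ` self-adjoint, not skew; this moves
`φ` from the third to the fourth curvature slot. -/
theorem g_φ_left (p : M) (v w : TangentSpace I p) :
    S.g.val p (S.φ p v) w = S.g.val p v (S.φ p w) := by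
  have h := S.g_φ_φ p v (S.φ p w)
  rw [S.φ_φ, S.η_φ, map_add, map_neg, map_smul, S.g_ξ, S.η_φ, smul_zero] at h
  linarith

theorem mdifferentiableAt_ξ (p : M) : MDiffAt (T% S.ξ) p :=
  (S.contMDiff_ξ p).mdifferentiableAt (by simp)

theorem contMDiffAt_φ {Y : ∀ p : M, TangentSpace I p} {p : M} (hY : CMDiffAt ∞ (T% Y) p) :
    CMDiffAt ∞ (T% (fun q ↦ S.φ q (Y q))) p :=
  ContMDiffAt.clm_bundle_apply (F₁ := E) (F₂ := E) (S.contMDiff_φ p) hY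

theorem mdifferentiableAt_φ {Y : ∀ p : M, TangentSpace I p} {p : M} (hY : MDiffAt (T% Y) p) :
    MDiffAt (T% (fun q ↦ S.φ q (Y q))) p :=
  MDifferentiableAt.clm_bundle_apply (F₁ := E) (F₂ := E)
    ((S.contMDiff_φ p).mdifferentiableAt (by simp)) hY

variable [FiniteDimensional ℝ E] {S}

/-- On a cosymplectic manifold, `φ` is parallel. -/
theorem IsCosymplectic.leviCivita_φ (hS : S.IsCosymplectic) {Y : ∀ p : M, TangentSpace I p} {p : M}
    (hY : MDiffAt (T% Y) p) (v : TangentSpace I p) :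
    S.g.leviCivita (fun q ↦ S.φ q (Y q)) p v = S.φ p (S.g.leviCivita Y p v) := by
  -- The hypothesis concerns smooth fields only. The Leibniz terms cancel in `∇φ`, so a merely
  -- differentiable `Y` may be replaced by a smooth extension of its value.
  have tens : TensorialAt I E
      (fun Y ↦ S.g.leviCivita (fun q ↦ S.φ q (Y q)) p v - S.φ p (S.g.leviCivita Y p v)) p :=
    { smul := fun {f Z} hf hZ ↦ by
        have e : (fun q ↦ S.φ q ((f • Z) q)) = f • fun q ↦ S.φ q (Z q) := by
          ext q; simp
        rw [e, S.g.leviCivita.isCovariantDerivativeOnUniv.leibniz (S.mdifferentiableAt_φ hZ) hf,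
          S.g.leviCivita.isCovariantDerivativeOnUniv.leibniz hZ hf]
        simp only [add_apply, smul_apply, ContinuousLinearMap.smulRight_apply, map_add, map_smul]
        module
      add := fun {Z Z'} hZ hZ' ↦ by
        have e : (fun q ↦ S.φ q ((Z + Z') q)) = (fun q ↦ S.φ q (Z q)) + fun q ↦ S.φ q (Z' q) := by
          ext q; simp
        rw [e, S.g.leviCivita.isCovariantDerivativeOnUniv.add (S.mdifferentiableAt_φ hZ)
          (S.mdifferentiableAt_φ hZ'), S.g.leviCivita.isCovariantDerivativeOnUniv.add hZ hZ']
        simp only [add_apply, map_add]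
        module }
  rw [← sub_eq_zero, tens.pointwise hY (FiberBundle.mdifferentiableAt_extend (I := I) E (Y p))
    (by simp)]
  refine S.g.nondegenerate p _ fun w ↦ ?_
  simpa [F] using hS p (FiberBundle.extend E v) (FiberBundle.extend E (Y p))
    (FiberBundle.extend E w) (FiberBundle.contMDiffAt_extend ..)
    (FiberBundle.contMDiffAt_extend ..) (FiberBundle.contMDiffAt_extend ..)

/-- On a cosymplectic manifold, `ξ` is parallel. -/
theorem IsCosymplectic.leviCivita_ξ (hS : S.IsCosymplectic) : S.g.leviCivita S.ξ = 0 := by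
  ext p v
  have h1 := hS.leviCivita_φ (S.mdifferentiableAt_ξ p) v
  have e : (fun q ↦ S.φ q (S.ξ q)) = 0 := funext fun q ↦ S.φ_ξ q
  rw [e, S.g.leviCivita.zero] at h1
  have h2 := congrArg (S.φ p) h1.symm
  rw [S.φ_φ] at h2
  -- `φ(∇_v ξ) = 0` leaves only a multiple of `ξ`, and `g(∇_v ξ, ξ)` is half the derivative of
  -- `g(ξ,ξ) = 1`.
  have h3 : S.η p (S.g.leviCivita S.ξ p v) = 0 := by
    have hv := FiberBundle.mdifferentiableAt_extend (I := I) E v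
    have := S.g.leviCivita_metric hv (S.mdifferentiableAt_ξ p) (S.mdifferentiableAt_ξ p)
    have e : S.g.pair S.ξ S.ξ = fun _ ↦ 1 := funext fun q ↦ by
      rw [PseudoRiemannianMetric.pair, S.g_ξ, S.η_ξ]
    rw [e, mvfderiv_const, S.g.symm p (S.ξ p), S.g_ξ] at this
    simp only [FiberBundle.extend_apply_self, zero_apply] at this
    linarith
  rw [h3, zero_smul, add_zero] at h2
  simpa using h2

/-- The Lie derivative of the metric along a vertical field `k ξ`. -/
theorem IsCosymplectic.lieDeriv_vertical (hS : S.IsCosymplectic) {ϑ : ∀ p : M, TangentSpace I p}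
    {k : M → ℝ} {p : M} (hk : MDiffAt k p) (hϑ : ∀ p, ϑ p = k p • S.ξ p)
    {X Y : ∀ p : M, TangentSpace I p} (hX : MDiffAt (T% X) p) (hY : MDiffAt (T% Y) p) :
    S.g.lieDeriv ϑ p X Y = S.h₁ k p (X p) (Y p) := by
  obtain rfl : ϑ = k • S.ξ := funext hϑ
  have hd : MDiffAt (T% (k • S.ξ)) p := hk.smul_section (S.mdifferentiableAt_ξ p)
  have hlc (v) : S.g.leviCivita (k • S.ξ) p v = mvfderiv I k p v • S.ξ p := by
    rw [S.g.leviCivita.isCovariantDerivativeOnUniv.leibniz (S.mdifferentiableAt_ξ p) hk]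
    change (k p • S.g.leviCivita S.ξ p + _) v = _
    rw [hS.leviCivita_ξ]
    simp
  -- Compatibility and zero torsion turn `(L_V g)(X,Y)` into `g(∇_X V, Y) + g(X, ∇_Y V)`.
  rw [PseudoRiemannianMetric.lieDeriv, S.g.leviCivita_metric hd hX hY]
  simp only [PseudoRiemannianMetric.pair]
  rw [← S.g.leviCivita_torsion_free hd hX, ← S.g.leviCivita_torsion_free hd hY, hlc, hlc]
  simp only [map_sub, sub_apply, map_smul, smul_apply, S.g_ξ, S.g.symm p (S.ξ p), smul_eq_mul, h₁]
  ring

theorem IsCosymplectic.curvature_ξ (hS : S.IsCosymplectic) (X Y : ∀ p : M, TangentSpace I p) :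
    S.g.curvature X Y S.ξ = 0 := by
  ext p
  simp only [PseudoRiemannianMetric.curvature, hS.leviCivita_ξ]
  have e : (fun q ↦ (0 : ∀ q : M, TangentSpace I q →L[ℝ] TangentSpace I q) q (X q)) = 0 := rfl
  have e' : (fun q ↦ (0 : ∀ q : M, TangentSpace I q →L[ℝ] TangentSpace I q) q (Y q)) = 0 := rfl
  rw [e, e', S.g.leviCivita.zero]
  simp

theorem IsCosymplectic.leviCivita_leviCivita_φ (hS : S.IsCosymplectic)
    {Y Z : ∀ p : M, TangentSpace I p} {p : M} (hY : CMDiffAt ∞ (T% Y) p)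
    (hZ : CMDiffAt ∞ (T% Z) p) (v : TangentSpace I p) :
    S.g.leviCivita (fun q ↦ S.g.leviCivita (fun r ↦ S.φ r (Z r)) q (Y q)) p v
      = S.φ p (S.g.leviCivita (fun q ↦ S.g.leviCivita Z q (Y q)) p v) := by
  have hd := (S.g.contMDiffAt_leviCivita hY hZ).mdifferentiableAt (by simp)
  have hd' := (S.g.contMDiffAt_leviCivita hY (S.contMDiffAt_φ hZ)).mdifferentiableAt (by simp)
  rw [← hS.leviCivita_φ hd]
  refine congrArg (· v) (S.g.leviCivita.isCovariantDerivativeOnUniv.congr_of_eventuallyEq hd'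
    (S.mdifferentiableAt_φ hd) Filter.univ_mem ?_)
  filter_upwards [hZ.eventually_mdifferentiableAt_section] with q hq using hS.leviCivita_φ hq _

theorem IsCosymplectic.curvature_φ (hS : S.IsCosymplectic) {X Y Z : ∀ p : M, TangentSpace I p}
    {p : M} (hX : CMDiffAt ∞ (T% X) p) (hY : CMDiffAt ∞ (T% Y) p) (hZ : CMDiffAt ∞ (T% Z) p) :
    S.g.curvature X Y (fun q ↦ S.φ q (Z q)) p = S.φ p (S.g.curvature X Y Z p) := by
  simp only [PseudoRiemannianMetric.curvature]
  rw [hS.leviCivita_leviCivita_φ hY hZ, hS.leviCivita_leviCivita_φ hX hZ,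
    hS.leviCivita_φ (hZ.mdifferentiableAt (by simp)), map_sub, map_sub]

/-- A cosymplectic accR manifold with a vertical almost Riemann soliton is flat; in dimension
at least `3` the function `σ` and the differential of `k` vanish. -/
theorem IsCosymplectic.flat_of_vertical_soliton (hS : S.IsCosymplectic)
    {ϑ : ∀ p : M, TangentSpace I p} {σ k : M → ℝ} (hk : MDifferentiable I 𝓘(ℝ) k)
    (hϑ : ∀ p, ϑ p = k p • S.ξ p) (hsol : IsAlmostRiemannSoliton S.g ϑ σ) :
    S.g.IsFlat ∧ (1 ≤ n → ∀ p, σ p = 0 ∧ mvfderiv I k p = 0) := by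
  -- By the soliton equation `K` is `-2R`; it manifestly depends only on values at `p`, so no
  -- separate proof that `R` is tensorial is needed.
  let K (p : M) (x y z w : TangentSpace I p) : ℝ :=
    σ p * kulkarniNomizu (fun v w ↦ S.g.val p v w) (fun v w ↦ S.g.val p v w) x y z w
      + kulkarniNomizu (fun v w ↦ S.g.val p v w)
        (fun v w ↦ mvfderiv I k p v * S.η p w + mvfderiv I k p w * S.η p v) x y z w
  have hK {p : M} {X Y Z : ∀ p : M, TangentSpace I p} (hX : CMDiffAt ∞ (T% X) p)
      (hY : CMDiffAt ∞ (T% Y) p) (hZ : CMDiffAt ∞ (T% Z) p) (w : TangentSpace I p) :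
      2 * S.g.val p (S.g.curvature X Y Z p) w = -K p (X p) (Y p) (Z p) w := by
    have hW := FiberBundle.contMDiffAt_extend (k := ∞) I E w
    have h := hsol.equation p X Y Z _ hX hY hZ hW
    have hd {X : ∀ p : M, TangentSpace I p} (hX : CMDiffAt ∞ (T% X) p) : MDiffAt (T% X) p :=
      hX.mdifferentiableAt (by simp)
    simp only [kulkarniNomizu, hS.lieDeriv_vertical (hk p) hϑ (hd hX) (hd hW),
      hS.lieDeriv_vertical (hk p) hϑ (hd hY) (hd hW), hS.lieDeriv_vertical (hk p) hϑ (hd hX) (hd hZ),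
      hS.lieDeriv_vertical (hk p) hϑ (hd hY) (hd hZ), PseudoRiemannianMetric.curvature04,
      PseudoRiemannianMetric.pair, FiberBundle.extend_apply_self, h₁] at h
    simp only [K, kulkarniNomizu]
    linarith
  have main (p : M) : (∀ x y z w, K p x y z w = 0) ∧
      (1 ≤ n → σ p = 0 ∧ (mvfderiv I k p).toLinearMap = 0) := by
    refine soliton_linear_algebra (V := TangentSpace I p) S.finrank_eq (fun v ↦ (S.g.val p v).toLinearMap) (S.g.symm p)
      (S.g.nondegenerate p) (S.φ p).toLinearMap (S.ξ p) (S.η p).toLinearMap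
      (mvfderiv I k p).toLinearMap (σ p) (S.φ_ξ p) (S.φ_φ p) (S.η_φ p) (S.η_ξ p) (S.g_φ_φ p)
      (K p) (fun _ _ _ _ ↦ rfl) (fun x y w ↦ ?_) fun x y z w ↦ ?_
    -- The third field is `ξ` itself, not an extension of its value, since it is this field that is
    -- parallel.
    · have h := hK (FiberBundle.contMDiffAt_extend (k := ∞) I E x)
        (FiberBundle.contMDiffAt_extend (k := ∞) I E y) (S.contMDiff_ξ p) w
      rw [hS.curvature_ξ, FiberBundle.extend_apply_self, FiberBundle.extend_apply_self,
        Pi.zero_apply, map_zero, zero_apply] at h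
      linarith
    · have hx := FiberBundle.contMDiffAt_extend (k := ∞) I E x
      have hy := FiberBundle.contMDiffAt_extend (k := ∞) I E y
      have hz := FiberBundle.contMDiffAt_extend (k := ∞) I E z
      have h := hK hx hy (S.contMDiffAt_φ hz) w
      have h' := hK hx hy hz (S.φ p w)
      rw [hS.curvature_φ hx hy hz, S.g_φ_left, h'] at h
      rw [neg_inj] at h
      simpa only [FiberBundle.extend_apply_self] using! h.symm
  refine ⟨fun p X Y Z hX hY hZ ↦ S.g.nondegenerate p _ fun w ↦ ?_, fun hn p ↦
    ⟨((main p).2 hn).1, ContinuousLinearMap.coe_injective ((main p).2 hn).2⟩⟩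
  have h := hK hX hY hZ w
  rw [(main p).1] at h
  linarith

end AccRStructure
end

/-! ### The theorem on manifolds modelled on Euclidean space. -/

theorem mainTheorem1 {n : ℕ} {M : Type*} [TopologicalSpace M]
    [ChartedSpace (EuclideanSpace ℝ (Fin (2 * n + 1))) M] [IsManifold (𝓡 (2 * n + 1)) ∞ M]
    (S : AccRStructure (𝓡 (2 * n + 1)) M n) (hS : S.IsCosymplectic)
    (ϑ : ∀ p : M, TangentSpace (𝓡 (2 * n + 1)) p) (σ k : M → ℝ)
    (hk : MDifferentiable (𝓡 (2 * n + 1)) 𝓘(ℝ) k)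
    (hϑ : ∀ p, ϑ p = k p • S.ξ p)
    (hsol : IsAlmostRiemannSoliton S.g ϑ σ) :
    S.g.IsFlat ∧
      (1 ≤ n → ∀ p, σ p = 0 ∧ mvfderiv (𝓡 (2 * n + 1)) k p (S.ξ p) = 0 ∧
        ∀ v w, S.h₁ k p v w = 0) := by
  obtain ⟨h1, h2⟩ := hS.flat_of_vertical_soliton hk hϑ hsol
  refine ⟨h1, fun hn p ↦ ?_⟩
  obtain ⟨hσ, hdk⟩ := h2 hn p
  exact ⟨hσ, by simp [hdk], fun v w ↦ by simp [AccRStructure.h₁, hdk]⟩
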